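/- A labeled plane tree on $[m]=\{1,\dots,m\}$ is a rooted plane tree with $m$ nodes labeled bijectively by $[m]$. For a node $\mathbf j$, let $\beta(\mathbf j)$ be the smallest label in the subtree rooted at $\mathbf j$. If $\mathbf j$ is a child of $\mathbf i$ and $\mathbf k_1,\dots,\mathbf k_{p}$ are the siblings to the left of $\mathbf j$, let $\alpha(\mathbf j)=\min(i,\beta(\mathbf k_1),\dots,\beta(\mathbf k_p))$. The edge $(\mathbf i,\mathbf j)$ is proper if $\alpha(\mathbf j)<\beta(\mathbf j)$ and improper otherwise. A leaf is a node without children. For $n\ge 0$ let $\widetilde N(n,k,r)$ be the number of labeled plane trees on $[n+1]$ with $k$ leaves and $r$ improper edges, and let $\widetilde N_B(n,k,r)$ be the number of labeled plane trees on $[n+2]$ with $k$ leaves and $r$ improper edges in which the node $\mathbf 1$ is a leaf and is the leftmost child of the node $\mathbf 2$. Put $$\widetilde N^A_n(x,y,s,t)=\sum_{k=1}^{n}\sum_{r=0}^{n}\widetilde N(n,k,r)\,s^{n-r}t^{r}x^{k}y^{n-k+1}\quad(n\ge1),\qquad \widetilde N^A_0(x,y,s,t)=y,$$ $$\widetilde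 N^B_n(x,y,s,t)=\sum_{k=1}^{n+1}\sum_{r=0}^{n+1}\widetilde N_B(n,k,r)\,s^{n+1-r}t^{r}x^{k-1}y^{n+1-k}\quad(n\ge0).$$ **Theorem.** Let $n\ge 0$. For all positive real numbers $s$ and $t$, the univariate polynomials in $x$ $$\widetilde N^A_n(x,1,s,t)=\sum_{k=1}^{n}\Bigl(\sum_{r=0}^{n}\widetilde N(n,k,r)s^{n-r}t^{r}\Bigr)x^{k}\ \ (n\ge 1)\qquad\text{(and }\widetilde N^A_0(x,1,s,t)=1\text{)},$$ $$\widetilde N^B_n(x,1,s,t)=\sum_{k=0}^{n}\Bigl(\sum_{r=0}^{n+1}\widetilde N_B(n,k+1,r)s^{n+1-r}t^{r}\Bigr)x^{k}$$ have only real roots. Moreover, their coefficients refine the Narayana numbers of type A and type B by the number of improper edges: $$\sum_{r=0}^{n}\widetilde N(n,k,r)=(n+1)!\,\frac1n\binom nk\binom n{k-1}\quad(1\le k\le n),\qquad \sum_{r=0}^{n+1}\widetilde N_B(n,k+1,r)=n!\binom nk^2\quad(0\le k\le n).$$ -/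

import Mathlib

open Polynomial

/-- A finite rooted plane tree whose nodes carry natural-number labels: a root label together
with the list, from left to right, of the subtrees hanging from the root. -/
inductive PlaneTree : Type
  | node (label : ℕ) (children : List PlaneTree) : PlaneTree

namespace PlaneTree

/-- The label of the root. -/
def label : PlaneTree → ℕ
  | node i _ => i

/-- The subtrees rooted at the children of the root, from left to right. -/
def children : PlaneTree → List PlaneTree
  | node _ cs => cs

mutual
/-- The list of the full subtrees of a tree, one for each of its nodes, in preorder. -/
def subtrees : PlaneTree → List PlaneTree
  | node i cs => node i cs :: forestSubtrees cs
/-- The list of the full subtrees of the trees of an ordered forest, in preorder. -/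
def forestSubtrees : List PlaneTree → List PlaneTree
  | [] => []
  | T :: F => subtrees T ++ forestSubtrees F
end

/-- The list of the labels of all nodes, in preorder. -/
def labels (T : PlaneTree) : List ℕ := T.subtrees.map label

/-- The number of leaves, that is, of nodes without children. -/
def numLeaves (T : PlaneTree) : ℕ := T.subtrees.countP fun S => S.children.isEmpty

/-- The `β`-value of the root of `T`: the smallest label in `T`. -/
def beta (T : PlaneTree) : ℕ := T.labels.foldr min T.label

/-- The number of improper edges from a node to the roots of the trees in a list of consecutive
children, where `a` is the `α`-value of the first of them. If a child has `α`-value `a`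
and `β`-value `b`, then its next sibling has `α`-value `min a b`, and the edge to the child is
proper if `a < b` and improper otherwise. -/
def improperAux : ℕ → List PlaneTree → ℕ
  | _, [] => 0
  | a, T :: F => (if a < T.beta then 0 else 1) + improperAux (min a T.beta) F

/-- The number of improper edges of a tree. The `α`-value of the leftmost child of a node is the
label of that node. -/
def numImproper (T : PlaneTree) : ℕ :=
  (T.subtrees.map fun S => improperAux S.label S.children).sum

/-- `T` has `m` nodes, labelled bijectively by `1, …, m`. -/
def IsLabeled (m : ℕ) (T : PlaneTree) : Prop :=
  T.labels.Perm (List.range' 1 m)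

/-- The node labelled `1` is a leaf, and it is the leftmost child of the node labelled `2`. -/
def HasMarkedLeaf (T : PlaneTree) : Prop :=
  ∃ F : List PlaneTree, node 2 (node 1 [] :: F) ∈ T.subtrees

end PlaneTree

/-- The number of labeled plane trees on `{1, …, n+1}` with `k` leaves and `r` improper edges. -/
noncomputable def treeCountA (n k r : ℕ) : ℕ :=
  Set.ncard {T : PlaneTree | T.IsLabeled (n + 1) ∧ T.numLeaves = k ∧ T.numImproper = r}

/-- The number of labeled plane trees on `{1, …, n+2}` with `k` leaves and `r` improper edges
in which the node `1` is a leaf and the leftmost child of the node `2`. -/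
noncomputable def treeCountB (n k r : ℕ) : ℕ :=
  Set.ncard {T : PlaneTree |
    T.IsLabeled (n + 2) ∧ T.HasMarkedLeaf ∧ T.numLeaves = k ∧ T.numImproper = r}

/-- The type A polynomial in `x, y, s, t`, evaluated at elements of a commutative ring. -/
noncomputable def narayanaTildeA {R : Type*} [CommRing R] (n : ℕ) (x y s t : R) : R :=
  if n = 0 then y else
    ∑ k ∈ Finset.Icc 1 n, ∑ r ∈ Finset.range (n + 1),
      (treeCountA n k r : R) * s ^ (n - r) * t ^ r * x ^ k * y ^ (n - k + 1)

/-- The type B polynomial in `x, y, s, t`, evaluated at elements of a commutative ring. -/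
noncomputable def narayanaTildeB {R : Type*} [CommRing R] (n : ℕ) (x y s t : R) : R :=
  ∑ k ∈ Finset.Icc 1 (n + 1), ∑ r ∈ Finset.range (n + 2),
    (treeCountB n k r : R) * s ^ (n + 1 - r) * t ^ r * x ^ (k - 1) * y ^ (n + 1 - k)

/-- The Narayana number of type A, for `1 ≤ k ≤ n`. -/
def narayanaNumberA (n k : ℕ) : ℚ := 1 / n * n.choose k * n.choose (k - 1)

/-- The Narayana number of type B. -/
def narayanaNumberB (n k : ℕ) : ℕ := n.choose k ^ 2

/-- Every complex root of the real polynomial `p` is real; in particular `p` is nonzero. -/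
def HasOnlyRealRoots (p : ℝ[X]) : Prop := ∀ z : ℂ, aeval z p = 0 → z.im = 0

-- Every labeled tree arises exactly once from a tree without the largest label `m` by choosing a
-- node `v` and a splitting of its children into `I` and `R`. Then either `m` becomes a leaf of `v`
-- between `I` and `R`, which creates no improper edge, or `m` takes the place of `v` and gets the
-- children `v` (keeping `I`) and `R`, which creates exactly one (`mem_inserts`,
-- `exists_mem_inserts_and`, `erase_inserts_and`). A tree with `n` edges has `2n+1` such choices of
-- each kind. Recording when the number of leaves grows gives a four-term recurrence for any
-- weighted sum over trees (`sum_trees_succ`).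
--
-- Type B reduces to the same recurrence. Deleting the marked leaf `1` leaves a tree on `2, …, n+2`,
-- in which leaves are counted except for a possible leaf `2`, and exactly one improper edge is lost
-- (`attach_spec_and`). So a single polynomial `treePoly`, with an excluded label `z` that occurs
-- `u` times (`u = 0` for type A, `u = 1` for type B), covers both cases.
--
-- The recurrence becomes `f_{n+1} = (s+t) x(1-x) f_n' + (αx + (n+u)t) f_n`. Since `f_n` is positive
-- on the positive axis, its real roots are nonpositive. The logarithmic derivative then shows that
-- this operator preserves real-rootedness when `(n+u)t > 0` (`HasOnlyRealRoots.derivative_step`).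
-- Forgetting improper edges turns the recurrence into one for leaf counts, which the Narayana
-- formulas satisfy (`leafCount_one_zero`, `leafCount_self`).

namespace List

/-- All ways to write a list as a concatenation of two lists. -/
def splits {α : Type*} : List α → List (List α × List α)
  | [] => [([], [])]
  | a :: l => ([], a :: l) :: (splits l).map fun p => (a :: p.1, p.2)

theorem mem_splits {α : Type*} {l : List α} {p : List α × List α} :
    p ∈ splits l ↔ p.1 ++ p.2 = l := by
  induction l generalizing p with
  | nil => obtain ⟨a, b⟩ := p; simp [splits]
  | cons a l ih =>
    obtain ⟨_ | ⟨b, c⟩, d⟩ := p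
    · simp [splits]
    · simp only [splits, mem_cons, Prod.mk.injEq, reduceCtorEq, false_and, mem_map, ih, false_or,
        cons_append, cons.injEq]
      constructor
      · rintro ⟨⟨x, y⟩, h, ⟨rfl, rfl⟩, rfl⟩
        exact ⟨rfl, h⟩
      · rintro ⟨rfl, h⟩
        exact ⟨(c, d), h, ⟨rfl, rfl⟩, rfl⟩

theorem nodup_splits {α : Type*} (l : List α) : (splits l).Nodup := by
  induction l with
  | nil => simp [splits]
  | cons a l ih =>
    refine nodup_cons.2 ⟨by simp, ih.map ?_⟩
    rintro ⟨x, y⟩ ⟨x', y'⟩ h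
    simpa using h

theorem length_splits {α : Type*} (l : List α) : (splits l).length = l.length + 1 := by
  induction l with
  | nil => simp [splits]
  | cons a l ih => simp [splits, ih]

end List

-- Inserting a node into a tree, and removing it

namespace PlaneTree

theorem induction_forest {P : PlaneTree → Prop} {Q : List PlaneTree → Prop}
    (node : ∀ v F, Q F → P (node v F)) (nil : Q []) (cons : ∀ T F, P T → Q F → Q (T :: F)) :
    (∀ T, P T) ∧ ∀ F, Q F :=
  ⟨fun T => PlaneTree.rec (motive_1 := P) (motive_2 := Q) node nil cons T,
    fun F => PlaneTree.rec_1 (motive_1 := P) (motive_2 := Q) node nil cons F⟩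

/-- The labels of all nodes of an ordered forest, in preorder. -/
def forestLabels (F : List PlaneTree) : List ℕ := (forestSubtrees F).map label

@[simp] theorem forestSubtrees_append (F G : List PlaneTree) :
    forestSubtrees (F ++ G) = forestSubtrees F ++ forestSubtrees G := by
  induction F with
  | nil => simp [forestSubtrees]
  | cons T F ih => simp [forestSubtrees, ih]

@[simp] theorem labels_node (v : ℕ) (F : List PlaneTree) :
    (node v F).labels = v :: forestLabels F := by
  simp [labels, subtrees, forestLabels, label]

@[simp] theorem forestLabels_nil : forestLabels [] = [] := by
  simp [forestLabels, forestSubtrees]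

@[simp] theorem forestLabels_cons (T : PlaneTree) (F : List PlaneTree) :
    forestLabels (T :: F) = T.labels ++ forestLabels F := by
  simp [forestLabels, forestSubtrees, labels]

@[simp] theorem forestLabels_append (F G : List PlaneTree) :
    forestLabels (F ++ G) = forestLabels F ++ forestLabels G := by
  simp [forestLabels]

theorem label_mem_labels (T : PlaneTree) : T.label ∈ T.labels := by
  cases T; simp [label]

theorem mem_forestLabels_of_mem {T : PlaneTree} {F : List PlaneTree} (hT : T ∈ F) {x : ℕ}
    (hx : x ∈ T.labels) : x ∈ forestLabels F := by
  obtain ⟨I, R, rfl⟩ := List.append_of_mem hT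
  simp [hx]

theorem forestLabels_eq_nil {F : List PlaneTree} : forestLabels F = [] ↔ F = [] := by
  cases F with
  | nil => simp
  | cons T F => cases T; simp

theorem labels_eq_singleton {T : PlaneTree} {m : ℕ} : T.labels = [m] ↔ T = node m [] := by
  cases T; simp [forestLabels_eq_nil]

mutual
/-- The trees which arise from a tree by inserting a node `m`: a node `v` of the tree and a
splitting of its list of children into two parts are chosen, and then `m` becomes either a new
leaf below `v` between the two parts, or a new node in the place of `v` whose children are `v`,
which keeps the first part, and the second part. -/
def inserts (m : ℕ) : PlaneTree → List PlaneTree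
  | node v F =>
    (F.splits.map fun p => node v (p.1 ++ node m [] :: p.2)) ++
      ((F.splits.map fun p => node m (node v p.1 :: p.2)) ++ (forestInserts m F).map (node v))
/-- The forests which arise by applying `inserts` to one of the trees of a forest. -/
def forestInserts (m : ℕ) : List PlaneTree → List (List PlaneTree)
  | [] => []
  | T :: F => (inserts m T).map (· :: F) ++ (forestInserts m F).map (T :: ·)
end

mutual
/-- Remove the node `m` from a tree; a left inverse of `inserts`. -/
def erase (m : ℕ) : PlaneTree → PlaneTree
  | node v F =>
    if v = m then
      match F with
      | [] => node v []
      | node c I :: R => node c (I ++ R)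
    else node v (forestErase m F)
/-- Remove the node `m` from a forest. -/
def forestErase (m : ℕ) : List PlaneTree → List PlaneTree
  | [] => []
  | T :: F => if T.labels = [m] then forestErase m F else erase m T :: forestErase m F
end

theorem mem_inserts {m v : ℕ} {F : List PlaneTree} {T' : PlaneTree} :
    T' ∈ inserts m (node v F) ↔
      (∃ I R, I ++ R = F ∧ T' = node v (I ++ node m [] :: R)) ∨
      (∃ I R, I ++ R = F ∧ T' = node m (node v I :: R)) ∨
      ∃ F' ∈ forestInserts m F, T' = node v F' := by
  simp only [inserts, List.mem_append, List.mem_map, List.mem_splits, Prod.exists, eq_comm]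

theorem mem_forestInserts_cons {m : ℕ} {T : PlaneTree} {F F' : List PlaneTree} :
    F' ∈ forestInserts m (T :: F) ↔
      (∃ T' ∈ inserts m T, F' = T' :: F) ∨ ∃ F₁ ∈ forestInserts m F, F' = T :: F₁ := by
  simp only [forestInserts, List.mem_append, List.mem_map, eq_comm]

theorem labels_perm_inserts_and (m : ℕ) :
    (∀ T, ∀ T' ∈ inserts m T, T'.labels.Perm (m :: T.labels)) ∧
    (∀ F, ∀ F' ∈ forestInserts m F, (forestLabels F').Perm (m :: forestLabels F)) := by
  refine induction_forest (fun v F ih T' hmem => ?_) (by simp [forestInserts])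
    (fun T F ihT ihF F' hmem => ?_)
  · rcases mem_inserts.1 hmem with ⟨I, R, rfl, rfl⟩ | ⟨I, R, rfl, rfl⟩ | ⟨F', h, rfl⟩
    · simp only [labels_node, forestLabels_append, forestLabels_cons, forestLabels_nil]
      grind
    · simp
    · simp only [labels_node]
      exact ((ih F' h).cons v).trans (.swap ..)
  · rcases mem_forestInserts_cons.1 hmem with ⟨T', h, rfl⟩ | ⟨F₁, h, rfl⟩
    · simpa using (ihT T' h).append_right (forestLabels F)
    · simp only [forestLabels_cons]
      exact ((ihF F₁ h).append_left _).trans List.perm_middle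

theorem labels_perm_inserts {m : ℕ} {T T' : PlaneTree} (h : T' ∈ inserts m T) :
    T'.labels.Perm (m :: T.labels) := (labels_perm_inserts_and m).1 T T' h

theorem length_of_mem_forestInserts {m : ℕ} {F F' : List PlaneTree}
    (hmem : F' ∈ forestInserts m F) : F'.length = F.length := by
  induction F generalizing F' with
  | nil => simp [forestInserts] at hmem
  | cons T F ih =>
    rcases mem_forestInserts_cons.1 hmem with ⟨T', h, rfl⟩ | ⟨F₁, h, rfl⟩
    · simp
    · simp [ih h]

theorem notMem_inserts_self (m : ℕ) (T : PlaneTree) : T ∉ inserts m T := fun h => by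
  simpa using (labels_perm_inserts h).length_eq

theorem labels_ne_singleton_of_mem_inserts {m : ℕ} {T T' : PlaneTree} (h : T' ∈ inserts m T) :
    T'.labels ≠ [m] := fun h' => by
  have := (labels_perm_inserts h).length_eq
  cases T
  simp [h'] at this

/-- A leaf `m` comes from an insertion below its parent. A node `m` with children comes from taking
the place of its leftmost child, whose former children are that child's present children followed by
the other children of `m`. In a forest, a root `m` without children has no parent inside the forest,
hence the extra alternative. -/
theorem exists_mem_inserts_and (m : ℕ) :
    (∀ T' : PlaneTree, m ∈ T'.labels → T' ≠ node m [] → ∃ T, T' ∈ inserts m T) ∧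
    (∀ F' : List PlaneTree, m ∈ forestLabels F' →
      (∃ I R, F' = I ++ node m [] :: R) ∨ ∃ F, F' ∈ forestInserts m F) := by
  refine induction_forest (fun v F ih h hne => ?_) (by simp) (fun T F ihT ihF h => ?_)
  · by_cases hv : v = m
    · subst hv
      match F with
      | [] => exact absurd rfl hne
      | node c I :: R => exact ⟨node c (I ++ R), mem_inserts.2 (.inr (.inl ⟨I, R, rfl, rfl⟩))⟩
    · have h : m ∈ forestLabels F := by simpa [Ne.symm hv] using h
      rcases ih h with ⟨I, R, rfl⟩ | ⟨F₀, h⟩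
      · exact ⟨node v (I ++ R), mem_inserts.2 (.inl ⟨I, R, rfl, rfl⟩)⟩
      · exact ⟨node v F₀, mem_inserts.2 (.inr (.inr ⟨F, h, rfl⟩))⟩
  · rcases List.mem_append.1 (forestLabels_cons T F ▸ h) with h | h
    · by_cases hT : T = node m []
      · exact .inl ⟨[], F, by simp [hT]⟩
      · obtain ⟨T₀, h⟩ := ihT h hT
        exact .inr ⟨T₀ :: F, mem_forestInserts_cons.2 (.inl ⟨T, h, rfl⟩)⟩
    · rcases ihF h with ⟨I, R, rfl⟩ | ⟨F₀, h⟩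
      · exact .inl ⟨T :: I, R, rfl⟩
      · exact .inr ⟨T :: F₀, mem_forestInserts_cons.2 (.inr ⟨F, h, rfl⟩)⟩

theorem erase_eq_self_and (m : ℕ) :
    (∀ T : PlaneTree, m ∉ T.labels → erase m T = T) ∧
    (∀ F : List PlaneTree, m ∉ forestLabels F → forestErase m F = F) := by
  refine induction_forest (fun v F ih h => ?_) (by simp [forestErase]) (fun T F ihT ihF h => ?_)
  · simp only [labels_node, List.mem_cons, not_or] at h
    simp [erase, Ne.symm h.1, ih h.2]
  · simp only [forestLabels_cons, List.mem_append, not_or] at h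
    have : T.labels ≠ [m] := fun h' => h.1 (by simp [h'])
    simp [forestErase, this, ihT h.1, ihF h.2]

theorem forestErase_append (m : ℕ) (F G : List PlaneTree) :
    forestErase m (F ++ G) = forestErase m F ++ forestErase m G := by
  induction F with
  | nil => simp [forestErase]
  | cons T F ih => by_cases h : T.labels = [m] <;> simp [forestErase, ih, h]

theorem erase_inserts_and (m : ℕ) :
    (∀ T, m ∉ T.labels → ∀ T' ∈ inserts m T, erase m T' = T) ∧
    (∀ F, m ∉ forestLabels F → ∀ F' ∈ forestInserts m F, forestErase m F' = F) := by
  refine induction_forest (fun v F ih hm T' hmem => ?_) (by simp [forestInserts])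
    (fun T F ihT ihF hm F' hmem => ?_)
  · simp only [labels_node, List.mem_cons, not_or] at hm
    rcases mem_inserts.1 hmem with ⟨I, R, rfl, rfl⟩ | ⟨I, R, rfl, rfl⟩ | ⟨F', h, rfl⟩
    · have h' := (erase_eq_self_and m).2 _ hm.2
      rw [forestErase_append] at h'
      simp [erase, Ne.symm hm.1, forestErase_append, forestErase, h']
    · simp [erase]
    · simp [erase, Ne.symm hm.1, ih hm.2 F' h]
  · simp only [forestLabels_cons, List.mem_append, not_or] at hm
    rcases mem_forestInserts_cons.1 hmem with ⟨T', h, rfl⟩ | ⟨F₁, h, rfl⟩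
    · simp [forestErase, labels_ne_singleton_of_mem_inserts h, ihT hm.1 T' h,
        (erase_eq_self_and m).2 F hm.2]
    · have : T.labels ≠ [m] := fun h' => hm.1 (by simp [h'])
      simp [forestErase, this, (erase_eq_self_and m).1 T hm.1, ihF hm.2 F₁ h]

theorem nodup_inserts_and (m : ℕ) :
    (∀ T : PlaneTree, m ∉ T.labels → (inserts m T).Nodup) ∧
    (∀ F : List PlaneTree, m ∉ forestLabels F → (forestInserts m F).Nodup) := by
  refine induction_forest (fun v F ih hm => ?_) (by simp [forestInserts])
    (fun T F ihT ihF hm => ?_)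
  · simp only [labels_node, List.mem_cons, not_or] at hm
    have hF : node m [] ∉ F := fun h => hm.2 (mem_forestLabels_of_mem h (by simp))
    refine List.Nodup.append ?_ (List.Nodup.append ?_ ((ih hm.2).map ?_) ?_) ?_
    -- The split is recovered from the position of the new leaf, because `node m []` does not occur
    -- in `F`.
    · refine (List.nodup_map_iff_inj_on (List.nodup_splits F)).2 ?_
      rintro ⟨I, R⟩ h ⟨I', R'⟩ h' heq
      have h := List.mem_splits.1 h
      simp only at h
      have hI : node m [] ∉ I := fun hI => hF (h ▸ List.mem_append_left R hI)
      have hR : node m [] ∉ R := fun hR => hF (h ▸ List.mem_append_right I hR)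
      have := (List.append_cons_inj_of_notMem hI hR).1 (node.inj heq).2
      simp [this]
    · refine (List.nodup_splits F).map ?_
      rintro ⟨I, R⟩ ⟨I', R'⟩ h
      simpa using h
    · intro F₁ F₂ h
      simpa using h
    · intro T h h'
      simp only [List.mem_map] at h h'
      obtain ⟨p, -, rfl⟩ := h
      obtain ⟨F', -, h'⟩ := h'
      exact hm.1 (node.inj h').1.symm
    · intro T h h'
      simp only [List.mem_append, List.mem_map] at h h'
      obtain ⟨p, hp, rfl⟩ := h
      rcases h' with ⟨q, -, h'⟩ | ⟨F', hF', h'⟩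
      · exact hm.1 (node.inj h').1
      -- Both trees have root `v`, but a new leaf below the root changes the number of its children,
      -- while an insertion deeper down does not.
      · have h₁ := length_of_mem_forestInserts hF'
        have h₂ := congrArg List.length (List.mem_splits.1 hp)
        have h₃ := congrArg List.length (node.inj h').2
        simp at h₁ h₂ h₃
        omega
  · simp only [forestLabels_cons, List.mem_append, not_or] at hm
    refine List.Nodup.append ((ihT hm.1).map ?_) ((ihF hm.2).map ?_) ?_
    · intro _ _ h; simpa using h
    · intro _ _ h; simpa using h
    · intro F' h h'
      simp only [List.mem_map] at h h'
      obtain ⟨T', hT', rfl⟩ := h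
      obtain ⟨F₁, -, h'⟩ := h'
      rw [← (List.cons.inj h').1] at hT'
      exact notMem_inserts_self m T hT'

-- Enumeration of all labeled trees by successive insertion

/-- A list of all trees labelled bijectively by `b, …, b + n`. -/
def trees (b : ℕ) : ℕ → List PlaneTree
  | 0 => [node b []]
  | n + 1 => (trees b n).flatMap (inserts (b + n + 1))

theorem mem_trees {b n : ℕ} {T : PlaneTree} :
    T ∈ trees b n ↔ T.labels.Perm (List.range' b (n + 1)) := by
  induction n generalizing T with
  | zero => simp [trees, labels_eq_singleton]
  | succ n ih =>
    have hr : (List.range' b (n + 1 + 1)).Perm ((b + n + 1) :: List.range' b (n + 1)) := by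
      rw [List.range'_concat, show b + 1 * (n + 1) = b + n + 1 by ring]
      exact List.perm_append_singleton ..
    simp only [trees, List.mem_flatMap]
    constructor
    · rintro ⟨T₀, h₀, h⟩
      exact (labels_perm_inserts h).trans (((ih.1 h₀).cons _).trans hr.symm)
    · intro h
      obtain ⟨T₀, h₀⟩ := (exists_mem_inserts_and (b + n + 1)).1 T
        ((h.trans hr).symm.subset (by simp)) (fun h' => by simpa [h'] using h.length_eq)
      exact ⟨T₀, ih.2 ((labels_perm_inserts h₀).symm.trans (h.trans hr)).cons_inv, h₀⟩

theorem lt_of_mem_trees {b n x : ℕ} {T : PlaneTree} (hT : T ∈ trees b n) (hx : x ∈ T.labels) :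
    x < b + n + 1 := by
  have := (mem_trees.1 hT).subset hx
  rw [List.mem_range'_1] at this
  omega

theorem nodup_trees (b n : ℕ) : (trees b n).Nodup := by
  induction n with
  | zero => simp [trees]
  | succ n ih =>
    have hm : ∀ T ∈ trees b n, b + n + 1 ∉ T.labels := fun T hT h =>
      (lt_of_mem_trees hT h).false
    refine List.nodup_flatMap.2 ⟨fun T hT => (nodup_inserts_and _).1 T (hm T hT), ?_⟩
    refine ih.imp_of_mem fun {T₁ T₂} h₁ h₂ hne => ?_
    intro T h h'
    exact hne (((erase_inserts_and _).1 T₁ (hm _ h₁) T h).symm.trans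
      ((erase_inserts_and _).1 T₂ (hm _ h₂) T h'))

-- Leaves, edges and improper edges under insertion

/-- The number of leaves with a label other than `z`. -/
def leavesOff (z : ℕ) (F : List PlaneTree) : ℕ :=
  (forestSubtrees F).countP fun S => S.children.isEmpty && S.label != z

/-- The number of nodes with children and with a label other than `z`. -/
def interiorOff (z : ℕ) (F : List PlaneTree) : ℕ :=
  (forestSubtrees F).countP fun S => !S.children.isEmpty && S.label != z

/-- The number of edges of a forest. -/
def forestEdges (F : List PlaneTree) : ℕ :=
  ((forestSubtrees F).map fun S => S.children.length).sum

/-- The number of improper edges of a forest. -/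
def forestImproper (F : List PlaneTree) : ℕ :=
  ((forestSubtrees F).map fun S => improperAux S.label S.children).sum

theorem leavesOff_append (z : ℕ) (F G : List PlaneTree) :
    leavesOff z (F ++ G) = leavesOff z F + leavesOff z G := by
  simp [leavesOff]

theorem leavesOff_cons (z v : ℕ) (I F : List PlaneTree) :
    leavesOff z (node v I :: F) =
      leavesOff z I + leavesOff z F + if I = [] ∧ v ≠ z then 1 else 0 := by
  simp only [leavesOff, forestSubtrees, subtrees, List.cons_append, List.countP_cons,
    List.countP_append, children, label]
  cases I <;> simp

theorem interiorOff_cons (z v : ℕ) (I F : List PlaneTree) :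
    interiorOff z (node v I :: F) =
      interiorOff z I + interiorOff z F + if I ≠ [] ∧ v ≠ z then 1 else 0 := by
  simp only [interiorOff, forestSubtrees, subtrees, List.cons_append, List.countP_cons,
    List.countP_append, children, label]
  cases I <;> simp

theorem forestEdges_cons (v : ℕ) (I F : List PlaneTree) :
    forestEdges (node v I :: F) = forestEdges I + forestEdges F + I.length := by
  simp only [forestEdges, forestSubtrees, subtrees, List.cons_append, List.map_cons,
    List.map_append, List.sum_cons, List.sum_append, children]
  ring

theorem forestImproper_append (F G : List PlaneTree) :
    forestImproper (F ++ G) = forestImproper F + forestImproper G := by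
  simp [forestImproper]

theorem forestImproper_cons (v : ℕ) (I F : List PlaneTree) :
    forestImproper (node v I :: F) = forestImproper I + forestImproper F + improperAux v I := by
  simp only [forestImproper, forestSubtrees, subtrees, List.cons_append, List.map_cons,
    List.map_append, List.sum_cons, List.sum_append, children, label]
  ring

@[simp] theorem leavesOff_nil (z : ℕ) : leavesOff z [] = 0 := by simp [leavesOff, forestSubtrees]
@[simp] theorem interiorOff_nil (z : ℕ) : interiorOff z [] = 0 := by
  simp [interiorOff, forestSubtrees]
@[simp] theorem forestEdges_nil : forestEdges [] = 0 := by simp [forestEdges, forestSubtrees]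
@[simp] theorem forestImproper_nil : forestImproper [] = 0 := by
  simp [forestImproper, forestSubtrees]

theorem leavesOff_cons' (z : ℕ) (T : PlaneTree) (F : List PlaneTree) :
    leavesOff z (T :: F) = leavesOff z [T] + leavesOff z F := leavesOff_append z [T] F
theorem forestImproper_cons' (T : PlaneTree) (F : List PlaneTree) :
    forestImproper (T :: F) = forestImproper [T] + forestImproper F := forestImproper_append [T] F
theorem interiorOff_cons' (z : ℕ) (T : PlaneTree) (F : List PlaneTree) :
    interiorOff z (T :: F) = interiorOff z [T] + interiorOff z F := by
  cases T; simp only [interiorOff_cons, interiorOff_nil]; ring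
theorem forestEdges_cons' (T : PlaneTree) (F : List PlaneTree) :
    forestEdges (T :: F) = forestEdges [T] + forestEdges F := by
  cases T; simp only [forestEdges_cons, forestEdges_nil]; ring

theorem numImproper_eq (T : PlaneTree) : T.numImproper = forestImproper [T] := by
  simp [numImproper, forestImproper, forestSubtrees]

theorem forestEdges_add_length (F : List PlaneTree) :
    forestEdges F + F.length = (forestLabels F).length := by
  refine (induction_forest (P := fun T => forestEdges [T] + 1 = T.labels.length)
    (Q := fun F => forestEdges F + F.length = (forestLabels F).length)
    (fun v F ih => ?_) (by simp) (fun T F ihT ihF => ?_)).2 F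
  · simp [forestEdges_cons, ih]
  · rw [forestEdges_cons', forestLabels_cons, List.length_append, ← ihT, ← ihF, List.length_cons]
    ring

theorem leavesOff_add_interiorOff (z : ℕ) (F : List PlaneTree) :
    leavesOff z F + interiorOff z F + (forestLabels F).count z = (forestLabels F).length := by
  simp only [leavesOff, interiorOff, forestLabels, List.length_map]
  induction forestSubtrees F with
  | nil => simp
  | cons T L ih =>
    simp only [List.countP_cons, List.map_cons, List.count_cons, List.length_cons]
    by_cases h : T.children.isEmpty <;> by_cases h' : T.label = z <;>
      simp [h, h'] <;> omega

theorem foldl_beta_spec (a : ℕ) (F : List PlaneTree)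
    (hF : ∀ T ∈ F, T.beta ∈ T.labels ∧ ∀ x ∈ T.labels, T.beta ≤ x) :
    (F.foldl (fun a T => min a T.beta) a ∈ a :: forestLabels F) ∧
      ∀ x ∈ a :: forestLabels F, F.foldl (fun a T => min a T.beta) a ≤ x := by
  induction F generalizing a with
  | nil => simp
  | cons T F ih =>
    obtain ⟨h₁, h₂⟩ := ih (min a T.beta) fun S hS => hF S (by simp [hS])
    obtain ⟨h₃, h₄⟩ := hF T (by simp)
    simp only [List.foldl_cons, forestLabels_cons, List.mem_cons, List.mem_append] at h₁ h₂ ⊢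
    constructor
    · rcases h₁ with h | h
      · rw [h]
        rcases min_choice a T.beta with h' | h' <;> rw [h'] <;> simp [h₃]
      · exact .inr (.inr h)
    · have := h₂ _ (.inl rfl)
      rintro x (rfl | hx | hx)
      · exact this.trans (min_le_left ..)
      · exact this.trans ((min_le_right ..).trans (h₄ x hx))
      · exact h₂ x (.inr hx)

theorem foldr_min_spec (a : ℕ) (l : List ℕ) :
    (l.foldr min a ∈ a :: l) ∧ ∀ x ∈ a :: l, l.foldr min a ≤ x := by
  induction l with
  | nil => simp
  | cons b l ih =>
    simp only [List.foldr_cons, List.mem_cons] at ih ⊢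
    rcases min_choice b (l.foldr min a) with h | h <;> grind

theorem beta_spec (T : PlaneTree) : T.beta ∈ T.labels ∧ ∀ x ∈ T.labels, T.beta ≤ x := by
  have h := foldr_min_spec T.label T.labels
  have h' := T.label_mem_labels
  refine ⟨?_, fun x hx => h.2 x (by simp [hx])⟩
  rcases List.mem_cons.1 h.1 with h | h
  · rw [beta, h]; exact h'
  · exact h

theorem beta_eq_of {T : PlaneTree} {b : ℕ} (h : b ∈ T.labels) (h' : ∀ x ∈ T.labels, b ≤ x) :
    T.beta = b :=
  le_antisymm (T.beta_spec.2 b h) (h' _ T.beta_spec.1)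

/-- The running minimum of `improperAux` after the children `F` is the `β`-value of `node v F`.
Hence moving `R` from behind `I` to behind the node `v` with children `I` leaves its `α`-values
unchanged. -/
theorem beta_node (v : ℕ) (F : List PlaneTree) :
    (node v F).beta = F.foldl (fun a T => min a T.beta) v := by
  have := foldl_beta_spec v F fun T _ => T.beta_spec
  exact beta_eq_of (by simpa using this.1) (by simpa using this.2)

theorem beta_inserts {m : ℕ} {T T' : PlaneTree} (hm : ∀ x ∈ T.labels, x < m)
    (h : T' ∈ inserts m T) : T'.beta = T.beta := by
  have hp := labels_perm_inserts h
  have hT := T.beta_spec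
  refine beta_eq_of (hp.mem_iff.2 (by simp [hT.1])) fun x hx => ?_
  rcases List.mem_cons.1 (hp.mem_iff.1 hx) with rfl | hx
  · exact (hm _ hT.1).le
  · exact hT.2 x hx

theorem improperAux_append (a : ℕ) (F G : List PlaneTree) :
    improperAux a (F ++ G) =
      improperAux a F + improperAux (F.foldl (fun a T => min a T.beta) a) G := by
  induction F generalizing a with
  | nil => simp [improperAux]
  | cons T F ih => simp [improperAux, ih, add_assoc]

theorem improperAux_congr (a : ℕ) {F G : List PlaneTree} (h : F.map beta = G.map beta) :
    improperAux a F = improperAux a G := by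
  induction F generalizing a G with
  | nil => cases G with
    | nil => rfl
    | cons => simp at h
  | cons T F ih => cases G with
    | nil => simp at h
    | cons S G =>
      simp only [List.map_cons, List.cons.injEq] at h
      simp [improperAux, h.1, ih _ h.2]

theorem map_beta_forestInserts {m : ℕ} {F F' : List PlaneTree}
    (hm : ∀ x ∈ forestLabels F, x < m) (hmem : F' ∈ forestInserts m F) :
    F'.map beta = F.map beta := by
  induction F generalizing F' with
  | nil => simp [forestInserts] at hmem
  | cons T F ih =>
    simp only [forestLabels_cons, List.mem_append] at hm
    rcases mem_forestInserts_cons.1 hmem with ⟨T', h, rfl⟩ | ⟨F₁, h, rfl⟩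
    · simp [beta_inserts (fun x hx => hm x (.inl hx)) h]
    · simp [ih (fun x hx => hm x (.inr hx)) h]

theorem beta_node_le (v : ℕ) (F : List PlaneTree) : (node v F).beta ≤ v :=
  (beta_spec _).2 v (by simp)

/-- The `α`-value at the new leaf is at most `v < m`, so the new edge is proper and the running
minimum passes to `R` unchanged. -/
theorem forestImproper_insert_leaf {m v : ℕ} (hv : v < m) (I R : List PlaneTree) :
    forestImproper [node v (I ++ node m [] :: R)] = forestImproper [node v (I ++ R)] := by
  have h := beta_node_le v I
  have hm : (node m []).beta = m := by simp [beta_node]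
  rw [beta_node] at h
  simp only [forestImproper_cons, forestImproper_append, improperAux_append, improperAux,
    forestImproper_nil, hm, min_eq_left (h.trans hv.le), h.trans_lt hv, if_true]
  ring

/-- The edge from `m` to `v` is improper because the subtree at `v` has `β`-value at most `v < m`.
After it the running minimum is this `β`-value, just what `R` saw behind `I`. -/
theorem forestImproper_insert_parent {m v : ℕ} (hv : v < m) (I R : List PlaneTree) :
    forestImproper [node m (node v I :: R)] = forestImproper [node v (I ++ R)] + 1 := by
  have h := beta_node_le v I
  have hI := beta_node v I
  simp only [forestImproper_cons, forestImproper_append, improperAux_append, improperAux,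
    forestImproper_nil, min_eq_right (h.trans hv.le), (h.trans hv.le).not_gt, if_false, ← hI]
  ring

/-- A node with `d` children has `d + 1` splits, so each kind of insertion has as many cases as
there are edges and nodes together. A new leaf `m` keeps the count only below a counted leaf. A new
parent `m` raises it only if `v ≠ z` has children and the first part is empty, for then `v` becomes
a leaf. The weight `g` is arbitrary so that the induction can shift its arguments by what the rest
of the tree contributes. -/
theorem sum_inserts_and {R : Type*} [CommSemiring R] {m z : ℕ} (hz : z ≠ m) :
    (∀ T : PlaneTree, (∀ x ∈ T.labels, x < m) → ∀ g : ℕ → ℕ → R,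
      ((inserts m T).map fun T' => g (leavesOff z [T']) (forestImproper [T'])).sum =
        leavesOff z [T] * g (leavesOff z [T]) (forestImproper [T]) +
        (forestEdges [T] + interiorOff z [T] + T.labels.count z : ℕ) *
          g (leavesOff z [T] + 1) (forestImproper [T]) +
        (forestEdges [T] + leavesOff z [T] + T.labels.count z : ℕ) *
          g (leavesOff z [T]) (forestImproper [T] + 1) +
        interiorOff z [T] * g (leavesOff z [T] + 1) (forestImproper [T] + 1)) ∧
    (∀ F : List PlaneTree, (∀ x ∈ forestLabels F, x < m) → ∀ g : ℕ → ℕ → R,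
      ((forestInserts m F).map fun F' => g (leavesOff z F') (forestImproper F')).sum =
        leavesOff z F * g (leavesOff z F) (forestImproper F) +
        (forestEdges F + interiorOff z F + (forestLabels F).count z : ℕ) *
          g (leavesOff z F + 1) (forestImproper F) +
        (forestEdges F + leavesOff z F + (forestLabels F).count z : ℕ) *
          g (leavesOff z F) (forestImproper F + 1) +
        interiorOff z F * g (leavesOff z F + 1) (forestImproper F + 1)) := by
  refine induction_forest (fun v F ih hm g => ?_) (by simp [forestInserts])
    (fun T F ihT ihF hm g => ?_)
  · simp only [labels_node, List.mem_cons, forall_eq_or_imp] at hm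
    obtain ⟨hv, hm⟩ := hm
    have hforest : (((forestInserts m F).map (node v)).map
        fun T' => g (leavesOff z [T']) (forestImproper [T'])) =
        (forestInserts m F).map fun F' =>
          (fun a b => g a (b + improperAux v F)) (leavesOff z F') (forestImproper F') := by
      rw [List.map_map]
      refine List.map_congr_left fun F' h => ?_
      -- An insertion inside `F` needs `F` nonempty, so `v` has children before and after.
      have hF' : F' ≠ [] := by
        rintro rfl
        have := length_of_mem_forestInserts h
        rw [List.length_nil, eq_comm, List.length_eq_zero_iff] at this
        simp [this, forestInserts] at h
      simp [leavesOff_cons, hF', forestImproper_cons,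
        improperAux_congr v (map_beta_forestInserts hm h)]
    have hleaf : ((F.splits.map fun p => node v (p.1 ++ node m [] :: p.2)).map
        fun T' => g (leavesOff z [T']) (forestImproper [T'])) =
        F.splits.map fun _ => g (leavesOff z F + 1) (forestImproper [node v F]) := by
      rw [List.map_map]
      refine List.map_congr_left fun p h => ?_
      obtain ⟨I, J⟩ := p
      obtain rfl := List.mem_splits.1 h
      simp [Function.comp, forestImproper_insert_leaf hv, leavesOff_cons,
        leavesOff_append, hz.symm, add_assoc]
    have hparent : (F.splits.map fun p => node m (node v p.1 :: p.2)).map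
        (fun T' => g (leavesOff z [T']) (forestImproper [T'])) =
        F.splits.map fun p => g (leavesOff z F + if p.1 = [] ∧ v ≠ z then 1 else 0)
          (forestImproper [node v F] + 1) := by
      rw [List.map_map]
      refine List.map_congr_left fun p h => ?_
      obtain ⟨I, J⟩ := p
      obtain rfl := List.mem_splits.1 h
      simp [Function.comp, forestImproper_insert_parent hv, leavesOff_cons,
        leavesOff_append, add_right_comm]
    rw [inserts, List.map_append, List.map_append, List.sum_append, List.sum_append, hleaf,
      hparent, hforest, ih hm fun a b => g a (b + improperAux v F)]
    simp only [List.map_const', List.sum_replicate, List.length_splits, leavesOff_cons,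
      interiorOff_cons, forestEdges_cons, labels_node, List.count_cons, forestImproper_cons,
      leavesOff_nil, interiorOff_nil, forestEdges_nil, forestImproper_nil]
    by_cases hvz : v = z <;> cases F with
    | nil =>
      simp [hvz, List.splits, improperAux]
      try ring
    | cons T F =>
      simp [hvz, List.splits, List.map_map, Function.comp_def, List.length_splits]
      ring_nf
  · simp only [forestLabels_cons, List.mem_append] at hm
    have h₁ := ihT (fun x hx => hm x (.inl hx))
      fun a b => g (a + leavesOff z F) (b + forestImproper F)
    have h₂ := ihF (fun x hx => hm x (.inr hx))
      fun a b => g (leavesOff z [T] + a) (forestImproper [T] + b)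
    simp only [forestInserts, List.map_append, List.sum_append, List.map_map, Function.comp_def]
    have e₁ : (fun T' => g (leavesOff z (T' :: F)) (forestImproper (T' :: F))) =
        fun T' => g (leavesOff z [T'] + leavesOff z F) (forestImproper [T'] + forestImproper F) := by
      funext T'
      rw [leavesOff_cons' z T' F, forestImproper_cons' T' F]
    have e₂ : (fun F' => g (leavesOff z (T :: F')) (forestImproper (T :: F'))) =
        fun F' => g (leavesOff z [T] + leavesOff z F') (forestImproper [T] + forestImproper F') := by
      funext F'
      rw [leavesOff_cons' z T F', forestImproper_cons' T F']
    rw [e₁, e₂, h₁, h₂, leavesOff_cons' z T F, forestImproper_cons' T F, interiorOff_cons' z T F,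
      forestEdges_cons' T F, forestLabels_cons, List.count_append]
    simp only [← add_assoc, add_right_comm (leavesOff z [T]) 1,
      add_right_comm (forestImproper [T]) 1]
    push_cast
    ring

/-- All trees in `trees b n` have `n` edges and `n + 1` nodes, `u` of them labelled `z`, so the four
coefficients depend only on `n`, `u` and the number of counted leaves. -/
theorem sum_trees_succ {R : Type*} [CommRing R] {b z u : ℕ} (n : ℕ) (hz : z ≤ b)
    (hu : u = if z = b then 1 else 0) (g : ℕ → ℕ → R) :
    ((trees b (n + 1)).map fun T => g (leavesOff z [T]) (forestImproper [T])).sum =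
      ((trees b n).map fun T => (fun k r : ℕ => k * g k r + (2 * n + 1 - k) * g (k + 1) r +
        (n + u + k) * g k (r + 1) + (n + 1 - u - k) * g (k + 1) (r + 1))
          (leavesOff z [T]) (forestImproper [T])).sum := by
  rw [trees, List.map_flatMap, List.flatMap_def, List.sum_flatten, List.map_map]
  congr 1
  refine List.map_congr_left fun T hT => ?_
  have hp := mem_trees.1 hT
  have hlen := hp.length_eq
  have h₁ := forestEdges_add_length [T]
  have h₂ := leavesOff_add_interiorOff z [T]
  have hc : T.labels.count z = u := by
    rw [hp.count_eq, hu, List.Nodup.count List.nodup_range']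
    simp only [List.mem_range'_1]
    congr 1
    apply propext
    omega
  simp only [forestLabels_cons, forestLabels_nil, List.append_nil, List.length_singleton,
    List.length_range', hlen, hc] at h₁ h₂
  have he : forestEdges [T] = n := by omega
  have hi : (interiorOff z [T] : R) = n + 1 - u - leavesOff z [T] := by
    rw [eq_sub_iff_add_eq, eq_sub_iff_add_eq]
    have : interiorOff z [T] + leavesOff z [T] + u = n + 1 := by omega
    have h := congrArg (Nat.cast (R := R)) this
    push_cast at h
    exact h
  simp only [Function.comp]
  rw [(sum_inserts_and (show z ≠ b + n + 1 by omega)).1 T (fun x hx => lt_of_mem_trees hT hx) g,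
    hc, he]
  push_cast
  rw [hi]
  ring

theorem forestImproper_le_of_mem_trees {b n : ℕ} {T : PlaneTree} (hT : T ∈ trees b n) :
    forestImproper [T] ≤ n := by
  have aux : ∀ a F, improperAux a F ≤ F.length := by
    intro a F
    induction F generalizing a with
    | nil => simp [improperAux]
    | cons T F ih =>
      have := ih (min a T.beta)
      simp only [improperAux, List.length_cons]
      split <;> omega
  have h : forestImproper [T] ≤ forestEdges [T] := by
    simp only [forestImproper, forestEdges]
    exact List.sum_le_sum fun S _ => aux _ _
  have h' := forestEdges_add_length [T]
  simp [(mem_trees.1 hT).length_eq] at h'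
  omega

theorem leavesOff_eq_numLeaves {z : ℕ} {T : PlaneTree} (hz : z ∉ T.labels) :
    leavesOff z [T] = T.numLeaves := by
  simp only [leavesOff, numLeaves, forestSubtrees, List.append_nil]
  refine List.countP_congr fun S hS => ?_
  have : S.label ≠ z := fun h => hz (h ▸ List.mem_map_of_mem hS)
  simp [this]

theorem leavesOff_congr {z w : ℕ} {F : List PlaneTree} (hz : z ∉ forestLabels F)
    (hw : w ∉ forestLabels F) : leavesOff z F = leavesOff w F := by
  refine List.countP_congr fun S hS => ?_
  have h₁ : S.label ≠ z := fun h => hz (h ▸ List.mem_map_of_mem hS)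
  have h₂ : S.label ≠ w := fun h => hw (h ▸ List.mem_map_of_mem hS)
  simp [h₁, h₂]

theorem improperAux_eq_zero {a : ℕ} {F : List PlaneTree} (h : ∀ x ∈ forestLabels F, a < x) :
    improperAux a F = 0 := by
  induction F with
  | nil => rfl
  | cons T F ih =>
    simp only [forestLabels_cons, List.mem_append] at h
    have hT := h _ (.inl T.beta_spec.1)
    simp [improperAux, hT, min_eq_left hT.le, ih fun x hx => h x (.inr hx)]

-- Type B trees: attaching the marked leaf

mutual
/-- Attach a leaf `1` to the node `2`, as its leftmost child. -/
def attach : PlaneTree → PlaneTree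
  | node v F => if v = 2 then node 2 (node 1 [] :: F) else node v (forestAttach F)
/-- Attach a leaf `1` to the node `2` of a forest, as its leftmost child. -/
def forestAttach : List PlaneTree → List PlaneTree
  | [] => []
  | T :: F => attach T :: forestAttach F
end

theorem attach_eq_self_and :
    (∀ T : PlaneTree, 2 ∉ T.labels → attach T = T) ∧
    (∀ F : List PlaneTree, 2 ∉ forestLabels F → forestAttach F = F) := by
  refine induction_forest (fun v F ih h => ?_) (by simp [forestAttach]) (fun T F ihT ihF h => ?_)
  · simp only [labels_node, List.mem_cons, not_or] at h
    simp [attach, Ne.symm h.1, ih h.2]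
  · simp only [forestLabels_cons, List.mem_append, not_or] at h
    simp [forestAttach, ihT h.1, ihF h.2]

theorem erase_attach_and :
    (∀ T : PlaneTree, 1 ∉ T.labels → erase 1 (attach T) = T) ∧
    (∀ F : List PlaneTree, 1 ∉ forestLabels F → forestErase 1 (forestAttach F) = F) := by
  refine induction_forest (fun v F ih h => ?_) (by simp [forestAttach, forestErase])
    (fun T F ihT ihF h => ?_)
  · simp only [labels_node, List.mem_cons, not_or] at h
    by_cases hv : v = 2
    · simp [attach, hv, erase, forestErase, (erase_eq_self_and 1).2 F h.2]
    · simp [attach, hv, erase, Ne.symm h.1, ih h.2]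
  · simp only [forestLabels_cons, List.mem_append, not_or] at h
    have : (attach T).labels ≠ [1] := by
      rw [Ne, labels_eq_singleton]
      cases T with
      | node v G =>
        simp only [labels_node, List.mem_cons, not_or] at h
        by_cases hv : v = 2 <;> simp [attach, hv, Ne.symm h.1.1]
    simp [forestAttach, forestErase, this, ihT h.1, ihF h.2]

theorem forestAttach_ne_nil {F : List PlaneTree} (h : F ≠ []) : forestAttach F ≠ [] := by
  cases F with
  | nil => exact absurd rfl h
  | cons => simp [forestAttach]

/-- The edge from `2` to `1` is improper, and the other children of `2` have `α`-value `2` before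
and `1` after, both below their labels. At an ancestor with `α`-value `a > 2`, the edge towards `2`
is improper whether its `β`-value is `2` or `1`, and the later siblings stay proper; this is the
last clause of the forest statement. The leaf `1` is counted, while `2` is no longer a leaf, which
explains the excluded label `2`. -/
theorem attach_spec_and :
    (∀ T : PlaneTree, T.labels.Nodup → (∀ x ∈ T.labels, 2 ≤ x) → 2 ∈ T.labels →
      (attach T).labels.Perm (1 :: T.labels) ∧ (attach T).HasMarkedLeaf ∧
      leavesOff 0 [attach T] = leavesOff 2 [T] + 1 ∧
      forestImproper [attach T] = forestImproper [T] + 1) ∧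
    (∀ F : List PlaneTree, (forestLabels F).Nodup → (∀ x ∈ forestLabels F, 2 ≤ x) →
      2 ∈ forestLabels F →
      (forestLabels (forestAttach F)).Perm (1 :: forestLabels F) ∧
      (∃ G, node 2 (node 1 [] :: G) ∈ forestSubtrees (forestAttach F)) ∧
      leavesOff 0 (forestAttach F) = leavesOff 2 F + 1 ∧
      forestImproper (forestAttach F) = forestImproper F + 1 ∧
      ∀ a, 2 < a → improperAux a (forestAttach F) = improperAux a F) := by
  refine induction_forest (fun v F ih hnd hle hmem => ?_) (by simp)
    (fun T F ihT ihF hnd hle hmem => ?_)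
  · simp only [labels_node, List.mem_cons, forall_eq_or_imp, List.nodup_cons] at hnd hle hmem
    by_cases hv : v = 2
    · subst hv
      have h₀ : 0 ∉ forestLabels F := fun h => by simpa using hle.2 0 h
      have hlt : ∀ x ∈ forestLabels F, 2 < x := fun x hx =>
        lt_of_le_of_ne (hle.2 x hx) fun h => hnd.1 (h ▸ hx)
      simp only [attach, if_true]
      refine ⟨?_, ⟨F, by simp [subtrees]⟩, ?_, ?_⟩
      · simpa using List.Perm.swap 1 2 _
      · simp [leavesOff_cons, leavesOff_congr h₀ hnd.1]
      · have h₁ : (node 1 []).beta = 1 := by simp [beta_node]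
        have h₂ : improperAux 1 F = 0 := improperAux_eq_zero fun x hx => by
          have := hlt x hx
          omega
        simp [forestImproper_cons, improperAux, h₁, h₂, improperAux_eq_zero hlt]
    · have hF : 2 ∈ forestLabels F := hmem.resolve_left (Ne.symm hv)
      obtain ⟨h₁, ⟨G, h₂⟩, h₃, h₄, h₅⟩ := ih hnd.2 hle.2 hF
      have hne : F ≠ [] := by rintro rfl; simp at hF
      simp only [attach, hv, if_false]
      refine ⟨?_, ⟨G, by simp [subtrees, h₂]⟩, ?_, ?_⟩
      · simpa using (h₁.cons v).trans (.swap ..)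
      · simp [leavesOff_cons, h₃, hne, forestAttach_ne_nil hne]
      · simp [forestImproper_cons, h₄, h₅ v (by omega)]
        ring
  · simp only [forestLabels_cons, List.nodup_append, List.mem_append] at hnd hle hmem
    obtain ⟨hT, hF, hTF⟩ := hnd
    by_cases h : 2 ∈ T.labels
    · have h' : 2 ∉ forestLabels F := fun h' => hTF 2 h 2 h' rfl
      have h₀ : 0 ∉ forestLabels F := fun h => by simpa using hle 0 (.inr h)
      have hlt : ∀ x ∈ forestLabels F, 2 < x := fun x hx =>
        lt_of_le_of_ne (hle x (.inr hx)) fun h => h' (h ▸ hx)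
      obtain ⟨h₁, ⟨G, h₂⟩, h₃, h₄⟩ := ihT hT (fun x hx => hle x (.inl hx)) h
      simp only [forestAttach, attach_eq_self_and.2 F h']
      refine ⟨by simpa using h₁.append_right (forestLabels F),
        ⟨G, by simp [forestSubtrees, h₂]⟩, ?_, ?_, fun a ha => ?_⟩
      · rw [leavesOff_cons', h₃, leavesOff_cons' 2 T F, leavesOff_congr h₀ h']
        ring
      · rw [forestImproper_cons', h₄, forestImproper_cons' T F]
        ring
      · have hb : T.beta = 2 := beta_eq_of h fun x hx => hle x (.inl hx)
        have hb' : (attach T).beta = 1 := by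
          refine beta_eq_of (h₁.mem_iff.2 (by simp)) fun x hx => ?_
          rcases List.mem_cons.1 (h₁.mem_iff.1 hx) with rfl | hx
          · rfl
          · have := hle x (.inl hx)
            omega
        have h₂ : improperAux 1 F = 0 := improperAux_eq_zero fun x hx => by
          have := hlt x hx
          omega
        have ha₁ : 1 ≤ a := by omega
        simp [improperAux, hb, hb', ha.not_gt, ha.le, ha₁, ha₁.not_gt, h₂, improperAux_eq_zero hlt]
    · have h' := hmem.resolve_left h
      obtain ⟨h₁, ⟨G, h₂⟩, h₃, h₄, h₅⟩ := ihF hF (fun x hx => hle x (.inr hx)) h'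
      have h₀ : 0 ∉ forestLabels [T] := fun h => by simpa using hle 0 (.inl (by simpa using h))
      simp only [forestAttach, attach_eq_self_and.1 T h]
      refine ⟨?_, ⟨G, by simp [forestSubtrees, h₂]⟩, ?_, ?_, fun a ha => ?_⟩
      · simp only [forestLabels_cons]
        exact (h₁.append_left _).trans List.perm_middle
      · rw [leavesOff_cons', h₃, leavesOff_cons' 2 T F,
          leavesOff_congr h₀ (w := 2) (by simpa using h)]
        ring
      · rw [forestImproper_cons', h₄, forestImproper_cons' T F]
        ring
      · have hb : 2 < T.beta := lt_of_le_of_ne (hle _ (.inl T.beta_spec.1))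
          fun hb => h (hb ▸ T.beta_spec.1)
        simp [improperAux, h₅ (min a T.beta) (lt_min ha hb)]

theorem exists_attach_and :
    (∀ T' : PlaneTree, T'.labels.Nodup → T'.HasMarkedLeaf →
      ∃ T, attach T = T' ∧ T'.labels.Perm (1 :: T.labels)) ∧
    (∀ F' : List PlaneTree, (forestLabels F').Nodup →
      (∃ G, node 2 (node 1 [] :: G) ∈ forestSubtrees F') →
      ∃ F, forestAttach F = F' ∧ (forestLabels F').Perm (1 :: forestLabels F)) := by
  have mem2 : ∀ {G : List PlaneTree} {L : List PlaneTree}, node 2 (node 1 [] :: G) ∈ L →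
      2 ∈ L.map label := fun h => List.mem_map.2 ⟨_, h, rfl⟩
  refine induction_forest (fun v F ih hnd hmem => ?_) (by simp [forestSubtrees])
    (fun T F ihT ihF hnd hmem => ?_)
  · simp only [labels_node, List.nodup_cons] at hnd
    obtain ⟨G, hG⟩ := hmem
    rcases List.mem_cons.1 (subtrees.eq_1 v F ▸ hG) with h | h
    · obtain ⟨rfl, rfl⟩ := node.inj h
      exact ⟨node 2 G, by simp [attach], by simpa using List.Perm.swap 1 2 _⟩
    · have hv : v ≠ 2 := by
        rintro rfl
        exact hnd.1 (mem2 h)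
      obtain ⟨F₀, rfl, hp⟩ := ih hnd.2 ⟨G, h⟩
      exact ⟨node v F₀, by simp [attach, hv], by simpa using (hp.cons v).trans (.swap ..)⟩
  · simp only [forestLabels_cons, List.nodup_append] at hnd
    obtain ⟨hT, hF, hTF⟩ := hnd
    obtain ⟨G, hG⟩ := hmem
    rcases List.mem_append.1 (forestSubtrees.eq_2 T F ▸ hG) with h | h
    · have h' : 2 ∉ forestLabels F := fun h' => hTF 2 (mem2 h) 2 h' rfl
      obtain ⟨T₀, rfl, hp⟩ := ihT hT ⟨G, h⟩
      exact ⟨T₀ :: F, by simp [forestAttach, attach_eq_self_and.2 F h'],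
        by simpa using hp.append_right (forestLabels F)⟩
    · have h' : 2 ∉ T.labels := fun h' => hTF 2 h' 2 (mem2 h) rfl
      obtain ⟨F₀, rfl, hp⟩ := ihF hF ⟨G, h⟩
      refine ⟨T :: F₀, by simp [forestAttach, attach_eq_self_and.1 T h'], ?_⟩
      simp only [forestLabels_cons]
      exact (hp.append_left _).trans List.perm_middle

theorem _root_.Set.ncard_setOf_mem_list {α : Type*} {L : List α} (hL : L.Nodup) (p : α → Bool) :
    {a | a ∈ L ∧ p a}.ncard = L.countP p := by
  classical
  have : {a | a ∈ L ∧ p a} = ((L.filter p).toFinset : Set α) := by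
    ext a; simp
  rw [this, Set.ncard_coe_finset, List.toFinset_card_of_nodup (hL.filter p),
    List.countP_eq_length_filter]

end PlaneTree

open PlaneTree

-- The tree counts in terms of the enumeration

theorem treeCountA_eq (n k r : ℕ) :
    treeCountA n k r =
      (trees 1 n).countP fun T => leavesOff 0 [T] == k && forestImproper [T] == r := by
  rw [treeCountA, ← Set.ncard_setOf_mem_list (nodup_trees 1 n)]
  congr 1
  ext T
  simp only [Set.mem_ofPred_eq, mem_trees, IsLabeled, Bool.and_eq_true, beq_iff_eq, numImproper_eq]
  refine and_congr_right fun h => ?_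
  rw [leavesOff_eq_numLeaves]
  intro h'
  simpa using h.subset h'

theorem treeCountB_eq (n k r : ℕ) :
    treeCountB n k r =
      (trees 2 n).countP fun T => leavesOff 2 [T] + 1 == k && forestImproper [T] + 1 == r := by
  rw [treeCountB, ← Set.ncard_setOf_mem_list (nodup_trees 2 n)]
  have hlab : ∀ T ∈ trees 2 n, T.labels.Nodup ∧ (∀ x ∈ T.labels, 2 ≤ x) ∧ 2 ∈ T.labels := by
    intro T hT
    have hp := mem_trees.1 hT
    refine ⟨hp.nodup_iff.2 List.nodup_range', fun x hx => ?_, hp.mem_iff.2 (by simp)⟩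
    simpa using (List.mem_range'_1.1 (hp.subset hx)).1
  have hinj : Set.InjOn attach {T | T ∈ trees 2 n} := by
    refine Set.LeftInvOn.injOn (f₁' := PlaneTree.erase 1) fun T hT => erase_attach_and.1 T fun h => ?_
    simpa using (hlab T hT).2.1 1 h
  rw [← Set.InjOn.ncard_image (s := {T | T ∈ trees 2 n ∧
    (leavesOff 2 [T] + 1 == k && forestImproper [T] + 1 == r) = true})
    (hinj.mono fun T hT => hT.1)]
  congr 1
  have hr : List.range' 1 (n + 2) = 1 :: List.range' 2 (n + 1) := by
    rw [List.range'_succ]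
  have h₀ : ∀ {T : PlaneTree}, T.labels.Perm (List.range' 1 (n + 2)) →
      leavesOff 0 [T] = T.numLeaves := fun h =>
    leavesOff_eq_numLeaves fun h' => by simpa using h.subset h'
  ext T'
  simp only [Set.mem_ofPred_eq, Set.mem_image, IsLabeled, Bool.and_eq_true, beq_iff_eq,
    numImproper_eq]
  constructor
  · rintro ⟨hp, hm, hk, hi⟩
    obtain ⟨T, rfl, hp'⟩ := exists_attach_and.1 T' (hp.nodup_iff.2 List.nodup_range') hm
    have hT : T ∈ trees 2 n := mem_trees.2 ((hp'.symm.trans (hr ▸ hp)).cons_inv)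
    obtain ⟨h₁, h₂, h₃⟩ := hlab T hT
    obtain ⟨-, -, h₄, h₅⟩ := attach_spec_and.1 T h₁ h₂ h₃
    exact ⟨T, ⟨hT, by rw [← h₄, h₀ hp, hk], by rw [← h₅, hi]⟩, rfl⟩
  · rintro ⟨T, ⟨hT, hk, hi⟩, rfl⟩
    obtain ⟨h₁, h₂, h₃⟩ := hlab T hT
    obtain ⟨hp, hm, h₄, h₅⟩ := attach_spec_and.1 T h₁ h₂ h₃
    have hp' : (attach T).labels.Perm (List.range' 1 (n + 2)) := by
      rw [hr]
      exact hp.trans ((mem_trees.1 hT).cons 1)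
    exact ⟨hp', hm, by rw [← h₀ hp', h₄, hk], by rw [h₅, hi]⟩

-- A differential operator preserving real-rootedness

/-- For real `w`, the imaginary part of `(z-1)/(z-w)` is `z.im * (1 - w) / |z-w|²`, which has the
sign of `z.im` when `w < 1`. -/
theorem im_mul_sum_inv_sub_nonneg (z : ℂ) (m : Multiset ℂ)
    (hm : ∀ w ∈ m, w.im = 0 ∧ w.re ≤ 0) :
    0 ≤ ((z - 1) * (m.map fun w => 1 / (z - w)).sum).im * z.im := by
  induction m using Multiset.induction_on with
  | empty => simp
  | cons w m ih =>
    have ih := ih fun w hw => hm w (Multiset.mem_cons_of_mem hw)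
    obtain ⟨h₁, h₂⟩ := hm w (Multiset.mem_cons_self w m)
    rw [Multiset.map_cons, Multiset.sum_cons, mul_add, Complex.add_im, add_mul]
    refine add_nonneg ?_ ih
    have : ((z - 1) * (1 / (z - w))).im * z.im =
        z.im ^ 2 * (1 - w.re) / Complex.normSq (z - w) := by
      simp only [one_div, Complex.mul_im, Complex.inv_re, Complex.inv_im, Complex.sub_re,
        Complex.sub_im, Complex.one_re, Complex.one_im, h₁]
      ring
    rw [this]
    have := Complex.normSq_nonneg (z - w)
    have : 0 ≤ 1 - w.re := by linarith
    positivity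

/-- At a nonreal root `z`, dividing by `f(z)` gives `(z-1) f'(z)/f(z) = α/c + (β/c)/z`. The
imaginary part of the left side has weakly the sign of `z.im`, that of the right side strictly the
opposite sign. -/
theorem HasOnlyRealRoots.derivative_step {f : ℝ[X]} {c α β : ℝ} (hc : 0 < c) (hβ : 0 < β)
    (hf : HasOnlyRealRoots f) (hpos : ∀ x : ℝ, 0 < x → f.eval x ≠ 0) :
    HasOnlyRealRoots (C c * (X * (1 - X)) * derivative f + (C α * X + C β) * f) := by
  intro z hz
  by_contra him
  have hz0 : z ≠ 0 := by rintro rfl; simp at him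
  set F : ℂ[X] := f.map (algebraMap ℝ ℂ) with hF
  have hev : ∀ w : ℂ, aeval w f = F.eval w := fun w => by rw [hF, eval_map_algebraMap]
  have hfz : F.eval z ≠ 0 := fun h => him (hf z (by rw [hev, h]))
  have hroots : ∀ w ∈ F.roots, w.im = 0 ∧ w.re ≤ 0 := by
    intro w hw
    have hw : aeval w f = 0 := by rw [hev]; exact (mem_roots'.1 hw).2
    have h := hf w hw
    refine ⟨h, not_lt.1 fun hlt => hpos _ hlt ?_⟩
    have hre : w = algebraMap ℝ ℂ w.re := Complex.ext rfl h
    rw [hre, aeval_algebraMap_apply, map_eq_zero_iff _ (algebraMap ℝ ℂ).injective] at hw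
    simpa using hw
  have hS := (IsAlgClosed.splits F).eval_derivative_div_eval_of_ne_zero hfz
  set S := (F.roots.map fun w => 1 / (z - w)).sum with hSdef
  have hd : aeval z (derivative f) = S * F.eval z := by
    rw [← hS, div_mul_cancel₀ _ hfz, hF, derivative_map, eval_map_algebraMap]
  have hcC : (c : ℂ) ≠ 0 := by exact_mod_cast hc.ne'
  simp only [map_add, map_mul, map_sub, aeval_C, aeval_X, map_one, hd, hev,
    Complex.coe_algebraMap] at hz
  have hz' : (c * (z * (1 - z)) * S + (α * z + β)) * F.eval z = 0 := by rw [← hz]; ring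
  have hz' := (mul_eq_zero.1 hz').resolve_right hfz
  have key : (z - 1) * S = (α / c : ℝ) + (β / c : ℝ) * z⁻¹ := by
    push_cast
    field_simp
    linear_combination -hz'
  have h := im_mul_sum_inv_sub_nonneg z F.roots hroots
  rw [← hSdef, key, Complex.add_im, Complex.ofReal_im, zero_add, Complex.im_ofReal_mul,
    Complex.inv_im] at h
  have h' : 0 < β / c * (z.im ^ 2 / Complex.normSq z) :=
    mul_pos (div_pos hβ hc) (div_pos (by positivity) (Complex.normSq_pos.2 hz0))
  have : β / c * (-z.im / Complex.normSq z) * z.im =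
    -(β / c * (z.im ^ 2 / Complex.normSq z)) := by ring
  linarith

theorem HasOnlyRealRoots.C_mul {f : ℝ[X]} {a : ℝ} (ha : a ≠ 0) (hf : HasOnlyRealRoots f) :
    HasOnlyRealRoots (C a * f) := by
  intro z hz
  refine hf z ?_
  simpa [ha] using hz

theorem hasOnlyRealRoots_one : HasOnlyRealRoots 1 := fun z hz => by simp at hz

theorem hasOnlyRealRoots_X : HasOnlyRealRoots X := fun z hz => by
  rw [aeval_X] at hz
  simp [hz]

theorem List.sum_countP_mul {α R : Type*} [CommSemiring R] (L : List α) (k r : α → ℕ)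
    (K S : Finset ℕ) (hK : ∀ a ∈ L, k a ∈ K) (hS : ∀ a ∈ L, r a ∈ S) (h : ℕ → ℕ → R) :
    ∑ i ∈ K, ∑ j ∈ S, (L.countP (fun a => k a == i && r a == j) : R) * h i j =
      (L.map fun a => h (k a) (r a)).sum := by
  induction L with
  | nil => simp
  | cons a L ih =>
    have ih := ih (fun b hb => hK b (by simp [hb])) (fun b hb => hS b (by simp [hb]))
    simp only [List.countP_cons, Nat.cast_add, add_mul, Finset.sum_add_distrib, ih,
      List.map_cons, List.sum_cons]
    rw [add_comm, Finset.sum_eq_single_of_mem (k a) (hK a (by simp)),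
      Finset.sum_eq_single_of_mem (r a) (hS a (by simp))]
    · simp
    · intro j _ hj
      simp [hj.symm]
    · intro i _ hi
      simp [hi.symm]

-- The generating polynomials and their real-rootedness

namespace PlaneTree

theorem leavesOff_pos (T : PlaneTree) (h : 0 ∉ T.labels) : 0 < leavesOff 0 [T] := by
  refine (induction_forest (P := fun T => 0 ∉ T.labels → 0 < leavesOff 0 [T])
    (Q := fun F => F ≠ [] → 0 ∉ forestLabels F → 0 < leavesOff 0 F)
    (fun v F ih h => ?_) (by simp) (fun T F ihT ihF _ h => ?_)).1 T h
  · simp only [labels_node, List.mem_cons, not_or] at h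
    rw [leavesOff_cons]
    by_cases hF : F = []
    · simp [hF, Ne.symm h.1]
    · exact Nat.add_pos_left (ih hF h.2) _
  · simp only [forestLabels_cons, List.mem_append, not_or] at h
    rw [leavesOff_cons']
    exact Nat.add_pos_left (ihT h.1) _

theorem leavesOff_mem_Icc {n : ℕ} (hn : 1 ≤ n) {T : PlaneTree} (hT : T ∈ trees 1 n) :
    leavesOff 0 [T] ∈ Finset.Icc 1 n := by
  have hp := mem_trees.1 hT
  have h0 : 0 ∉ T.labels := fun h => by simpa using hp.subset h
  refine Finset.mem_Icc.2 ⟨leavesOff_pos T h0, ?_⟩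
  have h := leavesOff_add_interiorOff 0 [T]
  have : 0 < interiorOff 0 [T] := by
    cases T with
    | node v F =>
      simp only [labels_node, List.mem_cons, not_or] at h0
      have hF : F ≠ [] := by
        rintro rfl
        have := hp.length_eq
        simp at this
        omega
      simp [interiorOff_cons, hF, Ne.symm h0.1]
  simp only [forestLabels_cons, forestLabels_nil, List.append_nil, hp.length_eq,
    List.length_range'] at h
  omega

theorem leavesOff_le {n b : ℕ} {T : PlaneTree} (hT : T ∈ trees b n) :
    leavesOff b [T] ≤ n := by
  have hp := mem_trees.1 hT
  have h := leavesOff_add_interiorOff b [T]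
  have : 0 < T.labels.count b := List.count_pos_iff.2 (hp.mem_iff.2 (by simp))
  simp only [forestLabels_cons, forestLabels_nil, List.append_nil, hp.length_eq,
    List.length_range'] at h
  omega

/-- The generating polynomial of the trees with labels `b, …, b + n`, where `x` marks the leaves
with a label other than `z`, and `t` and `s` mark the improper and the proper edges. -/
noncomputable def treePoly (b z : ℕ) (s t : ℝ) (n : ℕ) : ℝ[X] :=
  ((trees b n).map fun T =>
    (fun k r : ℕ => C (s ^ (n - r) * t ^ r) * X ^ k) (leavesOff z [T]) (forestImproper [T])).sum

/-- The parts of the four coefficients that are linear in `k` combine to `k (s+t)(1-X) X^k`, which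
is `(s+t) X (1-X)` times the derivative of `X^k`. The parts free of `k` give the multiplier of
`treePoly` itself. -/
theorem treePoly_succ {b z u : ℕ} (hz : z ≤ b) (hu : u = if z = b then 1 else 0) (s t : ℝ)
    (n : ℕ) :
    treePoly b z s t (n + 1) =
      C (s + t) * (X * (1 - X)) * derivative (treePoly b z s t n) +
      (C ((2 * n + 1) * s + (n + 1 - u) * t) * X + C ((n + u) * t)) * treePoly b z s t n := by
  have aux : ∀ (A B : ℝ[X]) (L : List PlaneTree) (f : PlaneTree → ℝ[X]),
      A * derivative (L.map f).sum + B * (L.map f).sum =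
        (L.map fun T => A * derivative (f T) + B * f T).sum := by
    intro A B L f
    induction L with
    | nil => simp
    | cons T L ih =>
      simp only [List.map_cons, List.sum_cons, derivative_add, ← ih]
      ring
  rw [treePoly, sum_trees_succ n hz hu fun k r => C (s ^ (n + 1 - r) * t ^ r) * X ^ k, treePoly,
    aux]
  congr 1
  refine List.map_congr_left fun T hT => ?_
  have hr := forestImproper_le_of_mem_trees hT
  generalize forestImproper [T] = r at hr ⊢
  generalize leavesOff z [T] = k
  have hX : (X : ℝ[X]) * derivative (X ^ k) = (k : ℝ[X]) * X ^ k := by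
    rcases k with _ | k
    · simp
    · rw [derivative_X_pow, Nat.add_sub_cancel, map_natCast]
      ring
  simp only [Nat.succ_sub hr, Nat.add_sub_add_right, derivative_C_mul, Nat.succ_eq_add_one]
  simp only [map_add, map_mul, map_sub, map_pow, map_natCast, map_one, map_ofNat, pow_succ]
  linear_combination (-(C s + C t) * (1 - X) * C s ^ (n - r) * C t ^ r) * hX

theorem treePoly_eval_pos {b z : ℕ} {s t : ℝ} (hs : 0 < s) (ht : 0 < t) (n : ℕ) {x : ℝ}
    (hx : 0 < x) : 0 < (treePoly b z s t n).eval x := by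
  have hne : trees b n ≠ [] := by
    -- The star with centre `b` shows that there is at least one tree.
    have : (node b ((List.range' (b + 1) n).map fun i => node i [])) ∈ trees b n := by
      rw [mem_trees, labels_node, List.range'_succ]
      have : ∀ l : List ℕ, forestLabels (l.map fun i => node i []) = l := by
        intro l
        induction l with
        | nil => simp
        | cons a l ih => simp [ih]
      rw [this]
    exact List.ne_nil_of_mem this
  rw [treePoly, ← coe_evalRingHom, map_list_sum, List.map_map]
  refine List.sum_pos _ (fun y hy => ?_) (by simpa using hne)
  obtain ⟨T, -, rfl⟩ := List.mem_map.1 hy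
  simp only [Function.comp, coe_evalRingHom, eval_mul, eval_C, eval_pow, eval_X]
  positivity

theorem hasOnlyRealRoots_treePoly_succ {b z u : ℕ} (hz : z ≤ b) (hu : u = if z = b then 1 else 0)
    {s t : ℝ} (hs : 0 < s) (ht : 0 < t) {n : ℕ} (hn : 0 < n + u)
    (h : HasOnlyRealRoots (treePoly b z s t n)) :
    HasOnlyRealRoots (treePoly b z s t (n + 1)) := by
  rw [treePoly_succ hz hu]
  refine h.derivative_step (add_pos hs ht) ?_ fun x hx => (treePoly_eval_pos hs ht n hx).ne'
  have : (0 : ℝ) < n + u := by exact_mod_cast hn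
  positivity

theorem treePoly_zero (b z : ℕ) (s t : ℝ) :
    treePoly b z s t 0 = if b = z then 1 else X := by
  by_cases h : b = z <;>
  simp [treePoly, trees, leavesOff_cons, h, forestImproper_cons, improperAux]

theorem hasOnlyRealRoots_treePoly_one_zero {s t : ℝ} (hs : 0 < s) (ht : 0 < t) (n : ℕ) :
    HasOnlyRealRoots (treePoly 1 0 s t n) := by
  induction n with
  | zero => simpa [treePoly_zero] using hasOnlyRealRoots_X
  | succ n ih =>
    rcases Nat.eq_zero_or_pos n with rfl | hn
    -- Here `n + u = 0`, so the criterion, which needs `β > 0`, does not apply and this step is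
    -- computed directly.
    · have : treePoly 1 0 s t (0 + 1) = C (s + t) * X := by
        rw [treePoly_succ (u := 0) (by simp) (by simp), treePoly_zero]
        simp
        ring
      rw [this]
      exact hasOnlyRealRoots_X.C_mul (add_pos hs ht).ne'
    · exact hasOnlyRealRoots_treePoly_succ (u := 0) (by simp) (by simp) hs ht hn ih

theorem hasOnlyRealRoots_treePoly_self {s t : ℝ} (hs : 0 < s) (ht : 0 < t) (b n : ℕ) :
    HasOnlyRealRoots (treePoly b b s t n) := by
  induction n with
  | zero => simpa [treePoly_zero] using hasOnlyRealRoots_one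
  | succ n ih =>
    exact hasOnlyRealRoots_treePoly_succ (u := 1) le_rfl (by simp) hs ht (by simp) ih

end PlaneTree

open PlaneTree

theorem narayanaTildeA_eq_treePoly {n : ℕ} (hn : 1 ≤ n) (s t : ℝ) :
    narayanaTildeA n (X : ℝ[X]) 1 (C s) (C t) = treePoly 1 0 s t n := by
  rw [narayanaTildeA, if_neg (by omega), treePoly, ← List.sum_countP_mul (trees 1 n)
    (fun T => leavesOff 0 [T]) (fun T => forestImproper [T])
    (Finset.Icc 1 n) (Finset.range (n + 1)) (fun T hT => leavesOff_mem_Icc hn hT)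
    (fun T hT => Finset.mem_range_succ_iff.2 (forestImproper_le_of_mem_trees hT))
    fun k r => C (s ^ (n - r) * t ^ r) * X ^ k]
  refine Finset.sum_congr rfl fun k _ => Finset.sum_congr rfl fun r _ => ?_
  rw [treeCountA_eq]
  simp only [map_mul, map_pow, one_pow]
  ring

/-- The factor `t` accounts for the improper edge from `2` to `1`. -/
theorem narayanaTildeB_eq_treePoly (n : ℕ) (s t : ℝ) :
    narayanaTildeB n (X : ℝ[X]) 1 (C s) (C t) = C t * treePoly 2 2 s t n := by
  have h := List.sum_countP_mul (trees 2 n) (fun T => leavesOff 2 [T] + 1)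
    (fun T => forestImproper [T] + 1) (Finset.Icc 1 (n + 1)) (Finset.range (n + 2))
    (fun T hT => Finset.mem_Icc.2 ⟨by simp, Nat.succ_le_succ (leavesOff_le hT)⟩)
    (fun T hT => Finset.mem_range.2 (by have := forestImproper_le_of_mem_trees hT; omega))
    fun k r => C (s ^ (n + 1 - r) * t ^ r) * X ^ (k - 1)
  rw [narayanaTildeB, treePoly, ← List.sum_map_mul_left]
  refine (Eq.trans (Finset.sum_congr rfl fun k _ => Finset.sum_congr rfl fun r _ => ?_) h).trans ?_
  · rw [treeCountB_eq]
    simp only [map_mul, map_pow, one_pow]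
    ring
  · congr 1
    refine List.map_congr_left fun T hT => ?_
    simp only [Nat.add_sub_add_right, map_mul, map_pow, pow_succ, Nat.add_sub_cancel]
    ring

theorem List.sum_countP_and {α : Type*} (L : List α) (k r : α → ℕ) (S : Finset ℕ)
    (hS : ∀ a ∈ L, r a ∈ S) (i : ℕ) :
    ∑ j ∈ S, (L.countP (fun a => k a == i && r a == j) : ℚ) =
      (L.map fun a => if k a = i then 1 else 0).sum := by
  induction L with
  | nil => simp
  | cons a L ih =>
    have ih := ih fun b hb => hS b (by simp [hb])
    simp only [List.countP_cons, Nat.cast_add, Finset.sum_add_distrib, ih,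
      List.map_cons, List.sum_cons]
    rw [add_comm, Finset.sum_eq_single_of_mem (r a) (hS a (by simp))]
    · simp
    · intro j _ hj
      simp [hj.symm]

-- Leaf counts and the Narayana numbers

namespace PlaneTree

/-- The number of trees with labels `b, …, b + n` and with `k` leaves whose label is not `z`. -/
def leafCount (b z n k : ℕ) : ℚ :=
  ((trees b n).map fun T => if leavesOff z [T] = k then 1 else 0).sum

theorem leafCount_zero (b z k : ℕ) :
    leafCount b z 0 k = if (if b = z then 0 else 1) = k then 1 else 0 := by
  by_cases h : b = z <;> simp [leafCount, trees, leavesOff_cons, h]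

theorem leafCount_succ_zero {b z u : ℕ} (n : ℕ) (hz : z ≤ b) (hu : u = if z = b then 1 else 0) :
    leafCount b z (n + 1) 0 = (n + u) * leafCount b z n 0 := by
  rw [leafCount, sum_trees_succ n hz hu fun k _ => if k = 0 then 1 else 0, leafCount,
    ← List.sum_map_mul_left]
  congr 1
  refine List.map_congr_left fun T _ => ?_
  by_cases h : leavesOff z [T] = 0 <;> simp [h]

/-- With improper edges ignored, the four terms of `sum_trees_succ` merge in pairs: `k + (n+u+k)` at
`k = j+1`, and `(2n+1-k) + (n+1-u-k)` at `k = j`. -/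
theorem leafCount_succ_succ {b z u : ℕ} (n j : ℕ) (hz : z ≤ b)
    (hu : u = if z = b then 1 else 0) :
    leafCount b z (n + 1) (j + 1) =
      (n + u + 2 * (j + 1)) * leafCount b z n (j + 1) +
        (3 * n + 2 - u - 2 * j) * leafCount b z n j := by
  rw [leafCount, sum_trees_succ n hz hu fun k _ => if k = j + 1 then 1 else 0, leafCount,
    leafCount, ← List.sum_map_mul_left, ← List.sum_map_mul_left, ← List.sum_map_add]
  congr 1
  refine List.map_congr_left fun T _ => ?_
  by_cases h : leavesOff z [T] = j + 1
  · simp [h]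
    ring
  · by_cases h' : leavesOff z [T] = j
    · simp [h']
      ring
    · simp [h, h']

theorem _root_.Nat.cast_choose_eq_succ_mul (n k : ℕ) :
    (n.choose k : ℚ) = (n + 1).choose (k + 1) * (k + 1) / (n + 1) := by
  rw [eq_div_iff (by positivity), mul_comm]
  exact_mod_cast Nat.add_one_mul_choose_eq n k

theorem _root_.Nat.cast_choose_eq_succ_sub_mul (n k : ℕ) :
    (n.choose k : ℚ) = (n + 1).choose k * (n + 1 - k) / (n + 1) := by
  have hn : (n + 1 : ℚ) ≠ 0 := by positivity
  cases k with
  | zero => simp [hn]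
  | succ k =>
    have h := Nat.cast_choose_eq_succ_mul n k
    have h' : ((n + 1).choose (k + 1) : ℚ) = n.choose k + n.choose (k + 1) := by
      exact_mod_cast Nat.choose_succ_succ n k
    rw [eq_div_iff hn] at h ⊢
    push_cast
    linear_combination -h - (n + 1 : ℚ) * h'

theorem leafCount_self (b n k : ℕ) :
    leafCount b b n k = n.factorial * (n.choose k : ℚ) ^ 2 := by
  induction n generalizing k with
  | zero => cases k <;> simp [leafCount_zero]
  | succ n ih =>
    cases k with
    | zero =>
      rw [leafCount_succ_zero (u := 1) n le_rfl (by simp), ih, Nat.factorial_succ]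
      simp
    | succ k =>
      rw [leafCount_succ_succ (u := 1) n k le_rfl (by simp), ih, ih, Nat.factorial_succ,
        Nat.cast_choose_eq_succ_mul n k, Nat.cast_choose_eq_succ_sub_mul n (k + 1)]
      have hn : (n + 1 : ℚ) ≠ 0 := by positivity
      push_cast
      field_simp
      ring

theorem leafCount_one_zero_zero (n : ℕ) : leafCount 1 0 n 0 = 0 := by
  induction n with
  | zero => simp [leafCount_zero]
  | succ n ih => rw [leafCount_succ_zero (u := 0) n (by simp) (by simp), ih, mul_zero]

theorem leafCount_one_zero (n k : ℕ) :
    leafCount 1 0 (n + 1) (k + 1) =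
      (n + 2).factorial * ((n + 1).choose (k + 1) * (n + 1).choose k / (n + 1)) := by
  induction n generalizing k with
  | zero =>
    rw [leafCount_succ_succ (u := 0) 0 k (by simp) (by simp), leafCount_zero, leafCount_zero]
    rcases k with _ | _ | k
    · norm_num
    · norm_num
    · simp [Nat.choose_eq_zero_of_lt]
  | succ n ih =>
    rw [leafCount_succ_succ (u := 0) (n + 1) k (by simp) (by simp), ih,
      Nat.factorial_succ (n + 2)]
    have hn : (n + 1 : ℚ) ≠ 0 := by positivity
    have hn' : (n + 1 + 1 : ℚ) ≠ 0 := by positivity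
    have e₁ := Nat.cast_choose_eq_succ_sub_mul (n + 1) (k + 1)
    have e₂ := Nat.cast_choose_eq_succ_sub_mul (n + 1) k
    have e₃ := Nat.cast_choose_eq_succ_mul (n + 1) k
    push_cast at e₁ e₂ e₃ ⊢
    cases k with
    | zero =>
      -- The induction hypothesis covers only positive leaf counts; for `k = 0` the second term
      -- vanishes, since every tree has a leaf.
      rw [leafCount_one_zero_zero, e₁]
      simp
      field_simp
      ring
    | succ k =>
      have e₄ := Nat.cast_choose_eq_succ_mul (n + 1) k
      rw [ih, e₁, e₄]
      push_cast at e₂ e₃ e₄ ⊢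
      generalize ((n + 1 + 1).choose (k + 1 + 1) : ℚ) = M₁ at *
      generalize ((n + 1 + 1).choose (k + 1) : ℚ) = M₂ at *
      generalize ((n + 1).choose (k + 1) : ℚ) = B at *
      -- The binomial `B` occurs in both terms of the recurrence. Writing it through `M₂` next to
      -- `M₁`, and through `M₁` next to `M₂`, makes both terms multiples of the target product `M₁ *
      -- M₂`.
      have h₂ : M₁ * B = M₁ * M₂ * (n + 1 + 1 - (k + 1)) / (n + 1 + 1) := by rw [e₂]; ring
      have h₃ : M₂ * B = M₁ * M₂ * (k + 1 + 1) / (n + 1 + 1) := by rw [e₃]; ring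
      field_simp at h₂ h₃ ⊢
      refine mul_right_cancel₀ hn' ?_
      linear_combination ((n + 1 + (k + 1 + 1) * 2 : ℚ) * (n + 1 + 1 - (k + 1 + 1))) * h₂ +
        ((k + 1 : ℚ) * ((n + 1) * 3 + 2 - (k + 1) * 2)) * h₃

end PlaneTree

open PlaneTree

theorem sum_treeCountA (n k : ℕ) :
    ∑ r ∈ Finset.range (n + 1), (treeCountA n k r : ℚ) = leafCount 1 0 n k := by
  simp only [treeCountA_eq]
  exact List.sum_countP_and _ (fun T => leavesOff 0 [T]) (fun T => forestImproper [T]) _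
    (fun T hT => Finset.mem_range_succ_iff.2 (forestImproper_le_of_mem_trees hT)) k

theorem sum_treeCountB (n k : ℕ) :
    ∑ r ∈ Finset.range (n + 2), (treeCountB n (k + 1) r : ℚ) = leafCount 2 2 n k := by
  simp only [treeCountB_eq]
  rw [List.sum_countP_and _ (fun T => leavesOff 2 [T] + 1) (fun T => forestImproper [T] + 1) _
    (fun T hT => Finset.mem_range.2 (by have := forestImproper_le_of_mem_trees hT; omega)) (k + 1)]
  simp [leafCount]

theorem mainTheorem4 (n : ℕ) :
    (∀ s t : ℝ, 0 < s → 0 < t →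
      HasOnlyRealRoots (narayanaTildeA n (X : ℝ[X]) 1 (C s) (C t)) ∧
      HasOnlyRealRoots (narayanaTildeB n (X : ℝ[X]) 1 (C s) (C t)) ∧
      (1 ≤ n → narayanaTildeA n (X : ℝ[X]) 1 (C s) (C t) =
        ∑ k ∈ Finset.Icc 1 n,
          C (∑ r ∈ Finset.range (n + 1), (treeCountA n k r : ℝ) * s ^ (n - r) * t ^ r) * X ^ k) ∧
      narayanaTildeB n (X : ℝ[X]) 1 (C s) (C t) =
        ∑ k ∈ Finset.range (n + 1),
          C (∑ r ∈ Finset.range (n + 2),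
            (treeCountB n (k + 1) r : ℝ) * s ^ (n + 1 - r) * t ^ r) * X ^ k) ∧
    (∀ k : ℕ, 1 ≤ k → k ≤ n →
      ∑ r ∈ Finset.range (n + 1), (treeCountA n k r : ℚ) =
        (n + 1).factorial * narayanaNumberA n k) ∧
    (∀ k : ℕ, k ≤ n →
      ∑ r ∈ Finset.range (n + 2), treeCountB n (k + 1) r =
        n.factorial * narayanaNumberB n k) := by
  refine ⟨fun s t hs ht => ⟨?_, ?_, fun hn => ?_, ?_⟩, fun k hk hkn => ?_, fun k _ => ?_⟩
  · rcases Nat.eq_zero_or_pos n with rfl | hn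
    · rw [narayanaTildeA, if_pos rfl]
      exact hasOnlyRealRoots_one
    · rw [narayanaTildeA_eq_treePoly hn]
      exact hasOnlyRealRoots_treePoly_one_zero hs ht n
  · rw [narayanaTildeB_eq_treePoly]
    exact (hasOnlyRealRoots_treePoly_self hs ht 2 n).C_mul ht.ne'
  · rw [narayanaTildeA, if_neg (by omega)]
    refine Finset.sum_congr rfl fun k _ => ?_
    rw [map_sum, Finset.sum_mul]
    refine Finset.sum_congr rfl fun r _ => ?_
    simp
  · rw [narayanaTildeB, Finset.range_eq_Ico, Finset.range_eq_Ico,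
      show Finset.Icc 1 (n + 1) = Finset.Ico (0 + 1) (n + 1 + 1) from rfl,
      ← Finset.sum_Ico_add']
    refine Finset.sum_congr rfl fun k _ => ?_
    rw [map_sum, Finset.sum_mul]
    refine Finset.sum_congr rfl fun r _ => ?_
    simp
  · rw [sum_treeCountA, narayanaNumberA]
    obtain ⟨n, rfl⟩ : ∃ m, n = m + 1 := ⟨n - 1, by omega⟩
    obtain ⟨k, rfl⟩ : ∃ m, k = m + 1 := ⟨k - 1, by omega⟩
    rw [leafCount_one_zero, Nat.add_sub_cancel]
    push_cast
    ring
  · have h := sum_treeCountB n k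
    rw [leafCount_self] at h
    rw [narayanaNumberB]
    exact_mod_cast h
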